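/- Let $X_1,X_2,\dots$ be i.i.d. random variables on a probability space, with values in $[0,\infty)$ almost surely and with distribution function $F(t)=\mathbb P(X_1\le t)$. Assume that $F$ is continuous and that the first and second derivatives $f=F'$ and $f'=F''$ exist, are continuous and are bounded on $[0,\infty)$ (derivatives at $0$ being one-sided). For $m,n\in\mathbb N$ let $$F_n(t)=\frac1n\sum_{i=1}^n \mathbb I(X_i\le t),\qquad \hat F^S_{m,n}(x)=\sum_{k=0}^\infty F_n\!\left(\frac km\right)V_{k,m}(x),\qquad V_{k,m}(x)=e^{-mx}\frac{(mx)^k}{k!},$$ be the empirical distribution function and the Szasz estimator. Then for each fixed $x\in(0,\infty)$ the random variable $\hat F^S_{m,n}(x)$ has a finite second moment and, as $m,n\to\infty$ (jointly, with no relation between $m$ and $n$), $$\mathbb E\big[\hat F^S_{m,n}(x)\big]-F(x)=m^{-1}\,\frac{x f'(x)}{2}+o_x(m^{-1}),$$ $$\operatorname{Var}\big[\hat F^S_{m,n}(x)\big]=n^{-1}F(x)\big(1-F(x)\big)-m^{-1/2}n^{-1} f(x)\sqrt{\frac{x}{\pi}}+o_x(m^{-1/2}n^{-1}).$$ Here $g=o_x(h)$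 means that $|g/h|\to0$ as $m,n\to\infty$, where the rate of convergence may depend on $x$. -/

import Mathlib

open MeasureTheory ProbabilityTheory Filter Topology Asymptotics

noncomputable section

/-- The Poisson weight `V_{k,m}(x) = e^{-mx} (mx)^k / k!`. -/
def szaszWeight (k m : ℕ) (x : ℝ) : ℝ :=
  Real.exp (-(m * x)) * (m * x) ^ k / (k.factorial : ℝ)

/-- The Szasz-Mirakyan operator `S_m(u; x) = ∑_{k ≥ 0} u(k/m) V_{k,m}(x)`. -/
def szaszOperator (m : ℕ) (u : ℝ → ℝ) (x : ℝ) : ℝ :=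
  ∑' k : ℕ, u ((k : ℝ) / m) * szaszWeight k m x

/-- For a bounded function the series defining the Szasz-Mirakyan operator converges
(absolutely). -/
theorem summable_szaszOperator (m : ℕ) (u : ℝ → ℝ) (x : ℝ) (C : ℝ) (hu : ∀ t, |u t| ≤ C) :
    Summable fun k : ℕ => u ((k : ℝ) / m) * szaszWeight k m x := by
  have h : Summable fun k : ℕ => szaszWeight k m x := by
    have := (Real.summable_pow_div_factorial (m * x)).mul_left (Real.exp (-(m * x)))
    simpa only [szaszWeight, mul_div_assoc] using this
  refine Summable.of_norm_bounded (h.norm.mul_left C) fun k => ?_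
  rw [norm_mul]
  exact mul_le_mul_of_nonneg_right (hu _) (norm_nonneg _)

/-- The empirical distribution function `F_n(t) = (1/n) ∑_{i ≤ n} 𝟙(X_i ≤ t)` of the first `n`
observations; the sequence of observations is indexed from `0`. -/
def empiricalCDF {Ω : Type*} (X : ℕ → Ω → ℝ) (n : ℕ) (ω : Ω) (t : ℝ) : ℝ :=
  (1 / (n : ℝ)) * ∑ i ∈ Finset.range n, (Set.Iic t).indicator (fun _ => (1 : ℝ)) (X i ω)

/-- The Szasz estimator: the Szasz-Mirakyan operator applied to the empirical distribution
function. -/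
def szaszEstimator {Ω : Type*} (X : ℕ → Ω → ℝ) (m n : ℕ) (x : ℝ) (ω : Ω) : ℝ :=
  szaszOperator m (empiricalCDF X n ω) x

/-- The bias `E[T] - θ` of an estimator `T` of the real number `θ`. -/
def estimatorBias {Ω : Type*} [MeasurableSpace Ω] (P : Measure Ω) (T : Ω → ℝ) (θ : ℝ) : ℝ :=
  (∫ ω, T ω ∂P) - θ

end

/-! ### Falling-factorial and central moments of the Poisson law. -/

section PoissonMoments

open scoped NNReal

/-! Let `K`, `K'` be independent Poisson variables of mean `mx`. The Szasz operator is `u ↦ E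
u(K/m)`, so the estimator is an average of `n` i.i.d. variables `G(X_i)` with `G(y) = P(y ≤ K/m)`.
By Fubini, `G(X_0)` has mean `E F(K/m)` and second moment `E F(min(K,K')/m)`. Thus the bias does not
depend on `n ≠ 0`, the variance is `n⁻¹` times a function of `m`, and the joint limit reduces to `m
→ ∞`.

Bias: in a second-order Taylor expansion at `x` the linear term is centred and the quadratic one has
mean `f'(x)/2 · x/m`.

Variance: since `min(a,b) = (a+b)/2 - |a-b|/2`, the linear term now contributes `-f(x)
E|K-K'|/(2m)`. By the central limit theorem `(K-K')/√m` tends to `N(0,2x)`; bounded second moments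
carry absolute means to the limit, so `E|K-K'|/√m → 2√(x/π)`. Everything else is `O(1/m)`. -/

theorem hasSum_poisson_mul_descFactorial (r : ℝ≥0) (j : ℕ) :
    HasSum (fun n : ℕ => Real.exp (-r) * r ^ n / (n.factorial : ℝ) * (n.descFactorial j : ℝ))
      ((r : ℝ) ^ j) := by
  -- The terms with `n < j` vanish; after the shift by `j` the factorials cancel and `r ^ j` times
  -- the Poisson mass remains.
  rw [← hasSum_nat_add_iff' j]
  have h0 : ∑ i ∈ Finset.range j,
      Real.exp (-r) * r ^ i / (i.factorial : ℝ) * (i.descFactorial j : ℝ) = 0 := by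
    refine Finset.sum_eq_zero fun i hi => ?_
    rw [Nat.descFactorial_eq_zero_iff_lt.2 (Finset.mem_range.1 hi)]
    simp
  rw [h0, sub_zero]
  have h := (hasSum_one_poissonMeasure r).mul_left ((r : ℝ) ^ j)
  rw [mul_one] at h
  refine h.congr_fun fun n => ?_
  have e : ((n.factorial : ℝ)) * ((n + j).descFactorial j : ℝ) = ((n + j).factorial : ℝ) := by
    have := Nat.factorial_mul_descFactorial (Nat.le_add_left j n)
    rw [Nat.add_sub_cancel] at this
    exact_mod_cast this
  have h1 : (n.factorial : ℝ) ≠ 0 := by positivity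
  have h2 : ((n + j).factorial : ℝ) ≠ 0 := by positivity
  rw [pow_add]
  field_simp
  linear_combination (r : ℝ) ^ n * (r : ℝ) ^ j * e

theorem integrable_and_integral_poissonMeasure_of_hasSum {r : ℝ≥0} {g : ℕ → ℝ} {a : ℝ}
    (hg : ∀ n, 0 ≤ g n)
    (h : HasSum (fun n : ℕ => Real.exp (-r) * r ^ n / (n.factorial : ℝ) * g n) a) :
    Integrable g (poissonMeasure r) ∧ ∫ n, g n ∂poissonMeasure r = a := by
  refine ⟨integrable_poissonMeasure_iff.2 ?_, ?_⟩
  · simpa only [Real.norm_of_nonneg (hg _)] using h.summable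
  · simpa only [integral_poissonMeasure, smul_eq_mul] using h.tsum_eq

theorem poissonMeasure_mean (r : ℝ≥0) :
    Integrable (fun n : ℕ => (n : ℝ)) (poissonMeasure r) ∧
      ∫ n, (n : ℝ) ∂poissonMeasure r = r := by
  refine integrable_and_integral_poissonMeasure_of_hasSum (fun n => Nat.cast_nonneg n) ?_
  simpa using hasSum_poisson_mul_descFactorial r 1

theorem poissonMeasure_centralMoment_two (r : ℝ≥0) :
    Integrable (fun n : ℕ => ((n : ℝ) - r) ^ 2) (poissonMeasure r) ∧
      ∫ n, ((n : ℝ) - r) ^ 2 ∂poissonMeasure r = r := by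
  refine integrable_and_integral_poissonMeasure_of_hasSum (fun n => by positivity) ?_
  have h := hasSum_poisson_mul_descFactorial r
  have := ((h 2).add ((h 1).mul_left (1 - 2 * (r : ℝ)))).add ((h 0).mul_left ((r : ℝ) ^ 2))
  convert this using 1
  · ext n
    simp only [← descPochhammer_eval_eq_descFactorial ℝ n, descPochhammer_succ_right,
      descPochhammer_zero]
    simp
    ring
  · ring

theorem poissonMeasure_centralMoment_four (r : ℝ≥0) :
    Integrable (fun n : ℕ => ((n : ℝ) - r) ^ 4) (poissonMeasure r) ∧
      ∫ n, ((n : ℝ) - r) ^ 4 ∂poissonMeasure r = 3 * r ^ 2 + r := by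
  refine integrable_and_integral_poissonMeasure_of_hasSum (fun n => by positivity) ?_
  have h := hasSum_poisson_mul_descFactorial r
  -- Coefficients of `(n - r) ^ 4` in the falling-factorial basis; 6 and 7 are Stirling numbers.
  have := ((((h 4).add ((h 3).mul_left (6 - 4 * (r : ℝ)))).add
    ((h 2).mul_left (7 - 12 * (r : ℝ) + 6 * (r : ℝ) ^ 2))).add
    ((h 1).mul_left (1 - 4 * (r : ℝ) + 6 * (r : ℝ) ^ 2 - 4 * (r : ℝ) ^ 3))).add
    ((h 0).mul_left ((r : ℝ) ^ 4))
  convert this using 1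
  · ext n
    simp only [← descPochhammer_eval_eq_descFactorial ℝ n, descPochhammer_succ_right,
      descPochhammer_zero]
    simp
    ring
  · ring

end PoissonMoments

/-! ### Absolute first moments: passage to the weak limit, and the Gaussian value. -/

theorem tendsto_integral_abs_of_tendsto {μ : ℕ → ProbabilityMeasure ℝ} {μ₀ : ProbabilityMeasure ℝ}
    (h : Tendsto μ atTop (𝓝 μ₀)) {C : ℝ}
    (hμ : ∀ n, Integrable (fun x : ℝ => x ^ 2) (μ n : Measure ℝ) ∧ ∫ x, x ^ 2 ∂(μ n : Measure ℝ) ≤ C)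
    (hμ₀ : Integrable (fun x : ℝ => x ^ 2) (μ₀ : Measure ℝ) ∧ ∫ x, x ^ 2 ∂(μ₀ : Measure ℝ) ≤ C) :
    Tendsto (fun n => ∫ x, |x| ∂(μ n : Measure ℝ)) atTop (𝓝 (∫ x, |x| ∂(μ₀ : Measure ℝ))) := by
  -- Truncation makes `|x|` bounded and continuous; its cost is uniform because `|x| - min |x| K ≤
  -- x² / K`.
  have key : ∀ (ν : ProbabilityMeasure ℝ) (K : ℝ), 0 < K →
      (Integrable (fun x : ℝ => x ^ 2) (ν : Measure ℝ) ∧ ∫ x, x ^ 2 ∂(ν : Measure ℝ) ≤ C) →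
      |∫ x, |x| ∂(ν : Measure ℝ) - ∫ x, min |x| K ∂(ν : Measure ℝ)| ≤ C / K := by
    intro ν K hK ⟨hi, hC⟩
    have i1 : Integrable (fun x : ℝ => |x|) (ν : Measure ℝ) := by
      refine ((integrable_const (1 : ℝ)).add hi).mono' (by fun_prop) (ae_of_all _ fun x => ?_)
      simp only [Pi.add_apply, Real.norm_eq_abs, abs_abs]
      nlinarith [sq_abs x, sq_nonneg (|x| - 1), abs_nonneg x]
    have i2 : Integrable (fun x : ℝ => min |x| K) (ν : Measure ℝ) :=
      i1.mono' (by fun_prop) (ae_of_all _ fun x => by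
        rw [Real.norm_of_nonneg (le_min (abs_nonneg _) hK.le)]
        exact min_le_left _ _)
    rw [← integral_sub i1 i2, abs_of_nonneg
      (integral_nonneg fun x => sub_nonneg.2 (min_le_left _ _))]
    calc _ ≤ ∫ x, x ^ 2 / K ∂(ν : Measure ℝ) := by
          refine integral_mono (i1.sub i2) (hi.div_const K) fun x => ?_
          beta_reduce
          rw [le_div_iff₀ hK]
          rcases le_total |x| K with h | h
          · rw [min_eq_left h]; nlinarith [sq_nonneg x]
          · rw [min_eq_right h]; nlinarith [sq_abs x, sq_nonneg (|x| - K)]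
      _ ≤ C / K := by
          rw [integral_div]
          gcongr
  have hC0 : 0 ≤ C := (integral_nonneg fun x => sq_nonneg x).trans hμ₀.2
  rw [Metric.tendsto_atTop]
  intro ε hε
  obtain ⟨K, hK, hKε⟩ : ∃ K : ℝ, 0 < K ∧ C / K < ε / 3 := by
    refine ⟨(C + 1) / (ε / 3), by positivity, ?_⟩
    rw [div_div_eq_mul_div, div_lt_iff₀ (by positivity)]
    nlinarith
  let g : BoundedContinuousFunction ℝ ℝ :=
    BoundedContinuousFunction.ofNormedAddCommGroup (fun x => min |x| K) (by fun_prop) K fun x => by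
      rw [Real.norm_of_nonneg (le_min (abs_nonneg _) hK.le)]
      exact min_le_right _ _
  have hg := (ProbabilityMeasure.tendsto_iff_forall_integral_tendsto.1 h) g
  obtain ⟨N, hN⟩ := (Metric.tendsto_atTop.1 hg) (ε / 3) (by positivity)
  refine ⟨N, fun n hn => ?_⟩
  have h1 := key (μ n) K hK (hμ n)
  have h2 := key μ₀ K hK hμ₀
  have h3 := hN n hn
  change dist (∫ x, min |x| K ∂(μ n : Measure ℝ)) (∫ x, min |x| K ∂(μ₀ : Measure ℝ)) < _ at h3
  rw [Real.dist_eq, abs_lt] at *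
  rw [abs_le] at h1 h2
  constructor <;> linarith [h1.1, h1.2, h2.1, h2.2, h3.1, h3.2]

open scoped NNReal in
theorem integral_abs_gaussianReal (v : ℝ≥0) (hv : v ≠ 0) :
    ∫ x, |x| ∂gaussianReal 0 v = √(2 * v / Real.pi) := by
  have hv' : (0 : ℝ) < v := by positivity
  have hpi := Real.pi_pos
  rw [integral_gaussianReal_eq_integral_smul hv]
  have e : ∀ x : ℝ, gaussianPDFReal 0 v x • |x| =
      (fun y : ℝ => (√(2 * Real.pi * v))⁻¹ * (y ^ (1 : ℝ) * Real.exp (-(1 / (2 * v)) * y ^ (2 : ℝ)))) |x| := by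
    intro x
    simp only [gaussianPDFReal, smul_eq_mul, Real.rpow_one, Real.rpow_two, sq_abs, sub_zero]
    ring_nf
  simp_rw [e]
  rw [integral_comp_abs (f := fun y : ℝ => (√(2 * Real.pi * v))⁻¹ * (y ^ (1 : ℝ) *
    Real.exp (-(1 / (2 * v)) * y ^ (2 : ℝ)))), integral_const_mul,
    integral_rpow_mul_exp_neg_mul_rpow (by norm_num) (by norm_num) (by positivity)]
  norm_num
  rw [Real.rpow_neg (by positivity), Real.rpow_one]
  have h2 : (√(2 : ℝ)) ^ 2 = 2 := Real.sq_sqrt (by norm_num)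
  have h3 : (√(v : ℝ)) ^ 2 = v := Real.sq_sqrt hv'.le
  field_simp
  linear_combination (-(v : ℝ)) * h2 - (√2 : ℝ) ^ 2 * h3

/-! ### Central limit theorem for the difference of two Poisson variables. -/

section PoissonDifference

open scoped NNReal

theorem charFun_poissonMeasure_prod_sub (r : ℝ≥0) (c t : ℝ) :
    charFun (((poissonMeasure r).prod (poissonMeasure r)).map
      fun p : ℕ × ℕ => c * ((p.1 : ℝ) - p.2)) t =
      Complex.exp ((2 * r * (Real.cos (c * t) - 1) : ℝ)) := by
  have h1 : ∀ s : ℝ, ∫ k : ℕ, Complex.exp (s * (k : ℝ) * Complex.I) ∂poissonMeasure r =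
      Complex.exp (r * (Complex.exp (s * Complex.I) - 1)) := by
    intro s
    rw [← charFun_map_cast_poissonMeasure, charFun_apply_real,
      integral_map .of_discrete (by fun_prop)]
  rw [charFun_apply_real, integral_map .of_discrete (by fun_prop)]
  have h2 : ∀ p : ℕ × ℕ, Complex.exp (t * ((c * ((p.1 : ℝ) - p.2) : ℝ) : ℂ) * Complex.I) =
      Complex.exp (((c * t : ℝ) : ℂ) * ((p.1 : ℝ) : ℂ) * Complex.I) *
      Complex.exp (((-(c * t) : ℝ) : ℂ) * ((p.2 : ℝ) : ℂ) * Complex.I) := by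
    intro p
    rw [← Complex.exp_add]
    congr 1
    push_cast
    ring
  simp_rw [h2]
  rw [integral_prod_mul (μ := poissonMeasure r) (ν := poissonMeasure r)
    (fun k : ℕ => Complex.exp (((c * t : ℝ) : ℂ) * ((k : ℝ) : ℂ) * Complex.I))
    (fun k : ℕ => Complex.exp (((-(c * t) : ℝ) : ℂ) * ((k : ℝ) : ℂ) * Complex.I)), h1, h1,
    ← Complex.exp_add]
  congr 1
  rw [Complex.exp_mul_I, Complex.exp_mul_I]
  push_cast
  rw [Complex.cos_neg, Complex.sin_neg]
  ring

/-- By `cos θ - 1 = -2 sin²(θ/2)` the expression is `-t²/2` times a squared `sinc`, which is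
continuous at `0`. -/
theorem tendsto_natCast_mul_cos_div_sqrt_sub_one (t : ℝ) :
    Tendsto (fun m : ℕ => (m : ℝ) * (Real.cos ((√(m : ℝ))⁻¹ * t) - 1)) atTop (𝓝 (-t ^ 2 / 2)) := by
  have h0 : Tendsto (fun m : ℕ => (√(m : ℝ))⁻¹ * t / 2) atTop (𝓝 0) := by
    have : Tendsto (fun m : ℕ => (√(m : ℝ))⁻¹ * t / 2) atTop (𝓝 (0 * t / 2)) :=
      (((tendsto_inv_atTop_zero.comp <| Real.tendsto_sqrt_atTop.comp <|
        tendsto_natCast_atTop_atTop).mul_const t).div_const 2)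
    simpa using this
  have h1 : Tendsto (fun m : ℕ => -t ^ 2 / 2 * Real.sinc ((√(m : ℝ))⁻¹ * t / 2) ^ 2) atTop
      (𝓝 (-t ^ 2 / 2 * Real.sinc 0 ^ 2)) :=
    (((Real.continuous_sinc.tendsto 0).comp h0).pow 2).const_mul _
  rw [Real.sinc_zero, one_pow, mul_one] at h1
  refine h1.congr' ?_
  filter_upwards [eventually_ge_atTop 1] with m hm
  have hm' : (0 : ℝ) < m := by exact_mod_cast hm
  have hs : √(m : ℝ) ^ 2 = m := Real.sq_sqrt hm'.le
  have hs' : √(m : ℝ) ≠ 0 := by positivity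
  rcases eq_or_ne t 0 with rfl | ht
  · simp
  have hc : Real.cos ((√(m : ℝ))⁻¹ * t) - 1 = -2 * Real.sin ((√(m : ℝ))⁻¹ * t / 2) ^ 2 := by
    have := Real.cos_two_mul ((√(m : ℝ))⁻¹ * t / 2)
    rw [mul_div_cancel₀ _ (two_ne_zero)] at this
    rw [this]
    linear_combination 2 * Real.sin_sq_add_cos_sq ((√(m : ℝ))⁻¹ * t / 2)
  rw [hc, Real.sinc_of_ne_zero (by positivity)]
  field_simp
  rw [hs]
  ring

/-- Gives uniform integrability after scaling; a bound of order `r` suffices, so the cross term is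
not computed. -/
theorem integral_poissonMeasure_prod_sub_sq_le (r : ℝ≥0) :
    Integrable (fun p : ℕ × ℕ => ((p.1 : ℝ) - p.2) ^ 2)
      ((poissonMeasure r).prod (poissonMeasure r)) ∧
    ∫ p : ℕ × ℕ, ((p.1 : ℝ) - p.2) ^ 2 ∂((poissonMeasure r).prod (poissonMeasure r)) ≤ 4 * r := by
  obtain ⟨hi, he⟩ := poissonMeasure_centralMoment_two r
  have i1 := hi.comp_fst (poissonMeasure r)
  have i2 := hi.comp_snd (poissonMeasure r)
  have hle : ∀ p : ℕ × ℕ, ((p.1 : ℝ) - p.2) ^ 2 ≤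
      2 * ((p.1 : ℝ) - r) ^ 2 + 2 * ((p.2 : ℝ) - r) ^ 2 := fun p => by
    nlinarith [sq_nonneg (((p.1 : ℝ) - r) + ((p.2 : ℝ) - r))]
  have ii := (i1.const_mul 2).add (i2.const_mul 2)
  have i3 : Integrable (fun p : ℕ × ℕ => ((p.1 : ℝ) - p.2) ^ 2)
      ((poissonMeasure r).prod (poissonMeasure r)) :=
    ii.mono' .of_discrete (ae_of_all _ fun p => by
      rw [Real.norm_of_nonneg (sq_nonneg _)]; exact hle p)
  refine ⟨i3, (integral_mono i3 ii hle).trans_eq ?_⟩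
  simp only [Pi.add_def]
  rw [integral_add (i1.const_mul 2) (i2.const_mul 2), integral_const_mul, integral_const_mul,
    integral_fun_fst (fun k : ℕ => ((k : ℝ) - r) ^ 2),
    integral_fun_snd (fun k : ℕ => ((k : ℝ) - r) ^ 2), he]
  simp
  ring

theorem tendsto_integral_abs_poissonMeasure_prod_sub {x : ℝ≥0} (hx : x ≠ 0) :
    Tendsto (fun m : ℕ => (√(m : ℝ))⁻¹ * ∫ p : ℕ × ℕ, |(p.1 : ℝ) - p.2|
      ∂((poissonMeasure (m * x)).prod (poissonMeasure (m * x)))) atTop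
      (𝓝 (2 * √(x / Real.pi))) := by
  let S : ℕ → ℕ × ℕ → ℝ := fun m p => (√(m : ℝ))⁻¹ * ((p.1 : ℝ) - p.2)
  have hS : ∀ m, Measurable (S m) := fun m => .of_discrete
  let μ : ℕ → ProbabilityMeasure ℝ := fun m =>
    ⟨((poissonMeasure (m * x)).prod (poissonMeasure (m * x))).map (S m),
      Measure.isProbabilityMeasure_map (hS m).aemeasurable⟩
  let μ₀ : ProbabilityMeasure ℝ := ⟨gaussianReal 0 (2 * x), inferInstance⟩
  have hconv : Tendsto μ atTop (𝓝 μ₀) := by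
    rw [ProbabilityMeasure.tendsto_iff_tendsto_charFun]
    intro t
    change Tendsto (fun m : ℕ => charFun (((poissonMeasure (m * x)).prod
      (poissonMeasure (m * x))).map (S m)) t) atTop (𝓝 (charFun (gaussianReal 0 (2 * x)) t))
    simp_rw [S, charFun_poissonMeasure_prod_sub]
    rw [charFun_gaussianReal]
    have h := (tendsto_natCast_mul_cos_div_sqrt_sub_one t).const_mul (2 * (x : ℝ))
    have h' := (Complex.continuous_exp.tendsto _).comp ((Complex.continuous_ofReal.tendsto _).comp h)
    convert h' using 2
    · simp only [Function.comp_apply]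
      push_cast
      ring_nf
    · push_cast
      ring_nf
  have hmap : ∀ m, Integrable (fun y : ℝ => y ^ 2) (μ m : Measure ℝ) ∧
      ∫ y, y ^ 2 ∂(μ m : Measure ℝ) ≤ 4 * x := by
    intro m
    obtain ⟨hi, hle⟩ := integral_poissonMeasure_prod_sub_sq_le (m * x)
    change Integrable _ (Measure.map (S m) _) ∧ ∫ y, y ^ 2 ∂(Measure.map (S m) _) ≤ _
    rw [integrable_map_measure (by fun_prop) (hS m).aemeasurable,
      integral_map (hS m).aemeasurable (by fun_prop)]
    simp only [Function.comp_def, S, mul_pow]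
    refine ⟨hi.const_mul _, ?_⟩
    rw [integral_const_mul, inv_pow, Real.sq_sqrt (Nat.cast_nonneg m)]
    rcases Nat.eq_zero_or_pos m with rfl | hm
    · simp
    · have hm' : (0 : ℝ) < m := by exact_mod_cast hm
      rw [inv_mul_le_iff₀ hm']
      push_cast at hle
      linarith
  have hgauss : Integrable (fun y : ℝ => y ^ 2) (μ₀ : Measure ℝ) ∧
      ∫ y, y ^ 2 ∂(μ₀ : Measure ℝ) ≤ 4 * x := by
    change Integrable (fun y : ℝ => y ^ 2) (gaussianReal 0 (2 * x)) ∧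
      ∫ y, y ^ 2 ∂(gaussianReal 0 (2 * x)) ≤ _
    refine ⟨(memLp_id_gaussianReal 2).integrable_sq, ?_⟩
    have h := variance_id_gaussianReal (μ := 0) (v := 2 * x)
    rw [variance_eq_integral (by fun_prop)] at h
    simp only [id, integral_id_gaussianReal, sub_zero] at h
    rw [h]
    push_cast
    nlinarith [x.coe_nonneg]
  have := tendsto_integral_abs_of_tendsto hconv hmap hgauss
  have e0 : ∫ y, |y| ∂(μ₀ : Measure ℝ) = 2 * √(x / Real.pi) := by
    change ∫ y, |y| ∂(gaussianReal 0 (2 * x)) = _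
    rw [integral_abs_gaussianReal _ (by positivity)]
    rw [← Real.sqrt_sq (show (0 : ℝ) ≤ 2 by norm_num), ← Real.sqrt_mul (by positivity)]
    push_cast
    ring_nf
  rw [e0] at this
  refine this.congr fun m => ?_
  change ∫ y, |y| ∂(Measure.map (S m) _) = _
  rw [integral_map (hS m).aemeasurable (by fun_prop), ← integral_const_mul]
  simp only [S, abs_mul, abs_of_nonneg (inv_nonneg.2 (Real.sqrt_nonneg (m : ℝ)))]

end PoissonDifference

/-! ### A Taylor bound valid on the whole line. -/

section Taylor

/-- Near `x`, differentiability of `f` and the mean value inequality give the `ε` term. Far from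
`x`, boundedness of `F` lets a fourth power dominate; its Poisson mean is only `O(m⁻²)`. -/
theorem exists_taylor_two_bound {F f : ℝ → ℝ} {f'x x B : ℝ} (hx : 0 < x)
    (hf : ∀ t ∈ Set.Ici (0 : ℝ), HasDerivWithinAt F (f t) (Set.Ici 0) t)
    (hf' : HasDerivWithinAt f f'x (Set.Ici 0) x)
    (hB : ∀ t, |F t| ≤ B) {ε : ℝ} (hε : 0 < ε) :
    ∃ C, 0 ≤ C ∧ ∀ t,
      |F t - F x - f x * (t - x) - f'x / 2 * (t - x) ^ 2| ≤ ε * (t - x) ^ 2 + C * (t - x) ^ 4 := by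
  have hd : HasDerivAt f f'x x := hf'.hasDerivAt (Ici_mem_nhds hx)
  have hlo := hd.isLittleO.def hε
  obtain ⟨δ₀, hδ₀, hball⟩ := Metric.eventually_nhds_iff_ball.1 hlo
  -- `δ ≤ x` keeps the segment from `x` to `t` in `(0,∞)`, where the one-sided derivatives are
  -- two-sided.
  set δ := min δ₀ x with hδ
  have hδpos : 0 < δ := lt_min hδ₀ hx
  set g : ℝ → ℝ := fun t => F t - F x - f x * (t - x) - f'x / 2 * (t - x) ^ 2 with hg
  have hgx : g x = 0 := by simp [hg]
  have near : ∀ t, |t - x| < δ → |g t| ≤ ε * (t - x) ^ 2 := by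
    intro t ht
    have hseg : ∀ s ∈ Set.uIcc x t, 0 < s ∧ |s - x| ≤ |t - x| ∧ s ∈ Metric.ball x δ₀ := by
      intro s hs
      have h1 : |s - x| ≤ |t - x| := Set.abs_sub_left_of_mem_uIcc hs
      have h2 : |s - x| < δ := h1.trans_lt ht
      refine ⟨?_, h1, ?_⟩
      · have := (abs_lt.1 (h2.trans_le (min_le_right _ _))).1
        linarith
      · rw [Metric.mem_ball, Real.dist_eq]
        exact h2.trans_le (min_le_left _ _)
    have hder : ∀ s ∈ Set.uIcc x t,
        HasDerivWithinAt g (f s - f x - f'x * (s - x)) (Set.uIcc x t) s := by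
      intro s hs
      have hFs : HasDerivAt F (f s) s :=
        (hf s (hseg s hs).1.le).hasDerivAt (Ici_mem_nhds (hseg s hs).1)
      have hid : HasDerivAt (fun u : ℝ => u - x) 1 s := (hasDerivAt_id s).sub_const x
      have := ((hFs.sub_const (F x)).sub (hid.const_mul (f x))).sub
        ((hid.pow 2).const_mul (f'x / 2))
      refine (this.congr_deriv ?_).hasDerivWithinAt
      simp
      ring
    have hbd : ∀ s ∈ Set.uIcc x t, ‖f s - f x - f'x * (s - x)‖ ≤ ε * |t - x| := by
      intro s hs
      have h := hball s (hseg s hs).2.2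
      rw [smul_eq_mul, mul_comm, Real.norm_eq_abs (s - x)] at h
      exact h.trans (mul_le_mul_of_nonneg_left (hseg s hs).2.1 hε.le)
    have := (convex_uIcc x t).norm_image_sub_le_of_norm_hasDerivWithin_le hder hbd
      Set.left_mem_uIcc Set.right_mem_uIcc
    rw [hgx, sub_zero, Real.norm_eq_abs, Real.norm_eq_abs, mul_assoc, abs_mul_abs_self] at this
    rwa [pow_two]
  have hB0 : 0 ≤ B := (abs_nonneg _).trans (hB 0)
  -- Each summand absorbs the term of degree 0, 1 or 2 into the fourth power, using `|t - x| ≥ δ`.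
  refine ⟨2 * B / δ ^ 4 + |f x| / δ ^ 3 + |f'x| / 2 / δ ^ 2, by positivity, fun t => ?_⟩
  change |g t| ≤ _
  rcases lt_or_ge |t - x| δ with h | h
  · exact (near t h).trans (le_add_of_nonneg_right (by positivity))
  · set d := |t - x| with hd'
    have hd4 : (t - x) ^ 4 = d ^ 4 := by rw [hd', pow_abs, abs_of_nonneg (by positivity)]
    have hd2 : (t - x) ^ 2 = d ^ 2 := (sq_abs _).symm
    have hd0 : 0 ≤ d := abs_nonneg _
    have a1 : |F t - F x| ≤ 2 * B := by
      have := abs_sub (F t) (F x)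
      linarith [hB t, hB x]
    have a2 : |g t| ≤ 2 * B + |f x| * d + |f'x| / 2 * d ^ 2 := by
      have e1 := abs_sub (F t - F x - f x * (t - x)) (f'x / 2 * (t - x) ^ 2)
      have e2 := abs_sub (F t - F x) (f x * (t - x))
      rw [abs_mul] at e2
      rw [abs_mul, abs_div, abs_of_pos (two_pos : (0 : ℝ) < 2), abs_of_nonneg (sq_nonneg (t - x)),
        hd2] at e1
      simp only [hg, hd2]
      linarith
    have b1 : 2 * B ≤ 2 * B / δ ^ 4 * d ^ 4 := by
      rw [div_mul_eq_mul_div, le_div_iff₀ (by positivity)]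
      gcongr
    have b2 : |f x| * d ≤ |f x| / δ ^ 3 * d ^ 4 := by
      rw [div_mul_eq_mul_div, le_div_iff₀ (by positivity), mul_assoc, pow_succ' d 3]
      gcongr
    have b3 : |f'x| / 2 * d ^ 2 ≤ |f'x| / 2 / δ ^ 2 * d ^ 4 := by
      rw [div_mul_eq_mul_div (|f'x| / 2), le_div_iff₀ (by positivity), mul_assoc,
        show d ^ 4 = d ^ 2 * d ^ 2 by ring]
      gcongr
    rw [hd4, hd2]
    have : 0 ≤ ε * d ^ 2 := by positivity
    linarith

end Taylor

/-! ### Expansions of the Poisson integrals as `m → ∞`. -/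

section SzaszAsymptotics

open scoped NNReal

theorem poissonMeasure_div_moments (x : ℝ≥0) {m : ℕ} (hm : 0 < m) :
    (Integrable (fun k : ℕ => (k : ℝ) / m - x) (poissonMeasure (m * x)) ∧
      ∫ k : ℕ, ((k : ℝ) / m - x) ∂poissonMeasure (m * x) = 0) ∧
    (Integrable (fun k : ℕ => ((k : ℝ) / m - x) ^ 2) (poissonMeasure (m * x)) ∧
      ∫ k : ℕ, ((k : ℝ) / m - x) ^ 2 ∂poissonMeasure (m * x) = x / m) ∧
    (Integrable (fun k : ℕ => ((k : ℝ) / m - x) ^ 4) (poissonMeasure (m * x)) ∧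
      ∫ k : ℕ, ((k : ℝ) / m - x) ^ 4 ∂poissonMeasure (m * x) ≤ (3 * x ^ 2 + x) / m ^ 2) := by
  have hm' : (0 : ℝ) < m := by exact_mod_cast hm
  have hm1 : (1 : ℝ) ≤ m := by exact_mod_cast hm
  have e : ∀ (k j : ℕ), ((k : ℝ) / m - x) ^ j = ((k : ℝ) - (m * x : ℝ≥0)) ^ j / m ^ j := by
    intro k j
    rw [← div_pow]
    congr 1
    push_cast
    field_simp
  obtain ⟨i1, h1⟩ := poissonMeasure_mean (m * x)
  obtain ⟨i2, h2⟩ := poissonMeasure_centralMoment_two (m * x)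
  obtain ⟨i4, h4⟩ := poissonMeasure_centralMoment_four (m * x)
  refine ⟨⟨(i1.div_const _).sub (integrable_const _), ?_⟩, ⟨?_, ?_⟩, ?_, ?_⟩
  · rw [integral_sub (i1.div_const _) (integrable_const _), integral_div, h1]
    simp
    field_simp
    simp
  · simp only [e]; exact i2.div_const _
  · simp only [e]
    rw [integral_div, h2]
    push_cast
    field_simp
  · simp only [e]; exact i4.div_const _
  · simp only [e]
    rw [integral_div, h4, div_le_div_iff₀ (by positivity) (by positivity)]
    push_cast
    have h0 : (0 : ℝ) ≤ x := x.coe_nonneg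
    have : (m : ℝ) * x ≤ m ^ 2 * x := by
      rw [pow_two]
      gcongr
      nlinarith
    nlinarith [pow_pos hm' 2]

theorem integrable_prod_poissonMeasure_of_abs_le {r s : ℝ≥0} {g : ℕ × ℕ → ℝ} {C : ℝ}
    (h : ∀ p, |g p| ≤ C) : Integrable g ((poissonMeasure r).prod (poissonMeasure s)) :=
  Integrable.of_bound .of_discrete C (ae_of_all _ h)

theorem isLittleO_integral_poissonMeasure_sub {F f : ℝ → ℝ} {f'x B : ℝ} {x : ℝ≥0} (hx : x ≠ 0)
    (hf : ∀ t ∈ Set.Ici (0 : ℝ), HasDerivWithinAt F (f t) (Set.Ici 0) t)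
    (hf' : HasDerivWithinAt f f'x (Set.Ici 0) x)
    (hB : ∀ t, |F t| ≤ B) :
    (fun m : ℕ => ∫ k : ℕ, F ((k : ℝ) / m) ∂poissonMeasure (m * x) - F x
      - (m : ℝ)⁻¹ * (x * f'x / 2)) =o[atTop] fun m : ℕ => (m : ℝ)⁻¹ := by
  have hx0 : (0 : ℝ) < x := by positivity
  rw [isLittleO_iff]
  intro ε hε
  -- As the second moment is `x / m`, the quadratic error becomes `ε / 2 · m⁻¹`; `N` gives the
  -- quartic error the other half.
  obtain ⟨C, hC0, hC⟩ := exists_taylor_two_bound hx0 hf hf' hB (ε := ε / (2 * x)) (by positivity)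
  obtain ⟨N, hN⟩ := exists_nat_ge (C * (3 * x ^ 2 + x) / (ε / 2))
  filter_upwards [eventually_ge_atTop (max N 1)] with m hm
  have hm1 : 0 < m := (le_max_right N 1).trans hm
  have hm' : (0 : ℝ) < m := by exact_mod_cast hm1
  have hNm : C * (3 * x ^ 2 + x) / (ε / 2) ≤ m :=
    hN.trans (by exact_mod_cast (le_max_left N 1).trans hm)
  obtain ⟨⟨i1, h1⟩, ⟨i2, h2⟩, i4, h4⟩ := poissonMeasure_div_moments x hm1
  set ν := poissonMeasure (m * x)
  have iF : Integrable (fun k : ℕ => F ((k : ℝ) / m)) ν :=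
    Integrable.of_bound .of_discrete B (ae_of_all _ fun k => hB _)
  have e : ∫ k : ℕ, (F ((k : ℝ) / m) - F x - f x * ((k : ℝ) / m - x)
      - f'x / 2 * ((k : ℝ) / m - x) ^ 2) ∂ν =
      ∫ k : ℕ, F ((k : ℝ) / m) ∂ν - F x - (m : ℝ)⁻¹ * (x * f'x / 2) := by
    rw [integral_sub ((iF.sub' (integrable_const _)).sub' (i1.const_mul _)) (i2.const_mul _),
      integral_sub (iF.sub' (integrable_const _)) (i1.const_mul _),
      integral_sub iF (integrable_const _), integral_const_mul, integral_const_mul, h1, h2]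
    simp
    ring
  rw [← e]
  refine (norm_integral_le_of_norm_le ((i2.const_mul (ε / (2 * x))).fun_add (i4.const_mul C))
    (ae_of_all _ fun k => hC _)).trans ?_
  rw [integral_add (i2.const_mul _) (i4.const_mul _), integral_const_mul, integral_const_mul, h2,
    Real.norm_of_nonneg (by positivity)]
  have h5 : C * ∫ k : ℕ, ((k : ℝ) / m - x) ^ 4 ∂ν ≤ C * ((3 * x ^ 2 + x) / m ^ 2) := by gcongr
  have h6 : C * ((3 * x ^ 2 + x) / m ^ 2) ≤ ε / 2 * (m : ℝ)⁻¹ := by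
    rw [div_le_iff₀ (by positivity)] at hNm
    rw [mul_div_assoc', div_le_iff₀ (by positivity)]
    calc _ ≤ _ := hNm
      _ = _ := by field_simp
  have h7 : ε / (2 * x) * (x / m) = ε / 2 * (m : ℝ)⁻¹ := by field_simp
  rw [h7]
  linarith

/-- Only the absolute-difference part of the minimum survives in the linear term. The quadratic term
need only be `O(1/m)`, so the Taylor bound is used with `ε = 1`. -/
theorem isBigO_integral_min_poissonMeasure_prod {F f : ℝ → ℝ} {f'x B : ℝ} {x : ℝ≥0} (hx : x ≠ 0)
    (hf : ∀ t ∈ Set.Ici (0 : ℝ), HasDerivWithinAt F (f t) (Set.Ici 0) t)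
    (hf' : HasDerivWithinAt f f'x (Set.Ici 0) x)
    (hB : ∀ t, |F t| ≤ B) :
    (fun m : ℕ => ∫ p : ℕ × ℕ, F (min ((p.1 : ℝ) / m) ((p.2 : ℝ) / m))
        ∂((poissonMeasure (m * x)).prod (poissonMeasure (m * x))) - F x
      + f x * ((m : ℝ)⁻¹ * ∫ p : ℕ × ℕ, |(p.1 : ℝ) - p.2|
        ∂((poissonMeasure (m * x)).prod (poissonMeasure (m * x)))) / 2) =O[atTop]
      fun m : ℕ => (m : ℝ)⁻¹ := by
  have hx0 : (0 : ℝ) < x := by positivity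
  obtain ⟨C, hC0, hC⟩ := exists_taylor_two_bound hx0 hf hf' hB (ε := 1) one_pos
  set A := 1 + |f'x| / 2 with hA
  refine IsBigO.of_bound (2 * (A * x + C * (3 * x ^ 2 + x))) ?_
  filter_upwards [eventually_ge_atTop 1] with m hm1
  have hm' : (0 : ℝ) < m := by exact_mod_cast hm1
  have hm1' : (1 : ℝ) ≤ m := by exact_mod_cast hm1
  obtain ⟨⟨i1, h1⟩, ⟨i2, h2⟩, i4, h4⟩ := poissonMeasure_div_moments x hm1
  obtain ⟨iD2, -⟩ := integral_poissonMeasure_prod_sub_sq_le (m * x)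
  set ν := poissonMeasure (m * x)
  have iF : Integrable (fun p : ℕ × ℕ => F (min ((p.1 : ℝ) / m) ((p.2 : ℝ) / m))) (ν.prod ν) :=
    integrable_prod_poissonMeasure_of_abs_le fun p => hB _
  have iD : Integrable (fun p : ℕ × ℕ => |(p.1 : ℝ) - p.2|) (ν.prod ν) := by
    refine ((integrable_const (1 : ℝ)).add iD2).mono' .of_discrete (ae_of_all _ fun p => ?_)
    simp only [Pi.add_apply, Real.norm_eq_abs, abs_abs]
    nlinarith [sq_abs ((p.1 : ℝ) - p.2), sq_nonneg (|(p.1 : ℝ) - p.2| - 1),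
      abs_nonneg ((p.1 : ℝ) - p.2)]
  have j1 := i1.comp_fst ν
  have j1' := i1.comp_snd ν
  have j2 := i2.comp_fst ν
  have j2' := i2.comp_snd ν
  have j4 := i4.comp_fst ν
  have j4' := i4.comp_snd ν
  have hmin : ∀ p : ℕ × ℕ, min ((p.1 : ℝ) / m) ((p.2 : ℝ) / m) - x =
      (((p.1 : ℝ) / m - x) + ((p.2 : ℝ) / m - x)) / 2 - (m : ℝ)⁻¹ * |(p.1 : ℝ) - p.2| / 2 := by
    intro p
    have h := max_sub_min_eq_abs ((p.1 : ℝ) / m) ((p.2 : ℝ) / m)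
    have h' := max_add_min ((p.1 : ℝ) / m) ((p.2 : ℝ) / m)
    have h'' : |(p.2 : ℝ) / m - (p.1 : ℝ) / m| = (m : ℝ)⁻¹ * |(p.1 : ℝ) - p.2| := by
      rw [← sub_div, abs_div, abs_of_pos hm', abs_sub_comm, div_eq_inv_mul]
    linarith
  have iM : Integrable (fun p : ℕ × ℕ => min ((p.1 : ℝ) / m) ((p.2 : ℝ) / m) - x) (ν.prod ν) := by
    simp only [hmin]
    exact ((j1.fun_add j1').div_const 2).sub' ((iD.const_mul _).div_const 2)
  have hM : ∫ p : ℕ × ℕ, (min ((p.1 : ℝ) / m) ((p.2 : ℝ) / m) - x) ∂(ν.prod ν) =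
      -((m : ℝ)⁻¹ * ∫ p : ℕ × ℕ, |(p.1 : ℝ) - p.2| ∂(ν.prod ν)) / 2 := by
    simp only [hmin]
    rw [integral_sub ((j1.fun_add j1').div_const 2) ((iD.const_mul _).div_const 2), integral_div,
      integral_div, integral_add j1 j1', integral_const_mul,
      integral_fun_fst (fun k : ℕ => (k : ℝ) / m - x),
      integral_fun_snd (fun k : ℕ => (k : ℝ) / m - x), h1]
    simp
    ring
  have e : ∫ p : ℕ × ℕ, (F (min ((p.1 : ℝ) / m) ((p.2 : ℝ) / m)) - F x
      - f x * (min ((p.1 : ℝ) / m) ((p.2 : ℝ) / m) - x)) ∂(ν.prod ν) =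
      ∫ p : ℕ × ℕ, F (min ((p.1 : ℝ) / m) ((p.2 : ℝ) / m)) ∂(ν.prod ν) - F x
      + f x * ((m : ℝ)⁻¹ * ∫ p : ℕ × ℕ, |(p.1 : ℝ) - p.2| ∂(ν.prod ν)) / 2 := by
    rw [integral_sub (iF.sub' (integrable_const _)) (iM.const_mul _),
      integral_sub iF (integrable_const _), integral_const_mul, hM]
    simp
    ring
  rw [← e]
  have hbd : ∀ p : ℕ × ℕ, ‖F (min ((p.1 : ℝ) / m) ((p.2 : ℝ) / m)) - F x
      - f x * (min ((p.1 : ℝ) / m) ((p.2 : ℝ) / m) - x)‖ ≤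
      A * (((p.1 : ℝ) / m - x) ^ 2 + ((p.2 : ℝ) / m - x) ^ 2) +
      C * (((p.1 : ℝ) / m - x) ^ 4 + ((p.2 : ℝ) / m - x) ^ 4) := by
    intro p
    have hT : ∀ t : ℝ, |F t - F x - f x * (t - x)| ≤ A * (t - x) ^ 2 + C * (t - x) ^ 4 := by
      intro t
      have h := abs_add_le (F t - F x - f x * (t - x) - f'x / 2 * (t - x) ^ 2)
        (f'x / 2 * (t - x) ^ 2)
      rw [sub_add_cancel, abs_mul, abs_div, abs_of_pos (two_pos : (0 : ℝ) < 2),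
        abs_of_nonneg (sq_nonneg (t - x))] at h
      have := hC t
      rw [hA]
      linarith
    refine (hT _).trans ?_
    -- The minimum is one of the coordinates, so the sum over both bounds the remainder.
    rcases min_choice ((p.1 : ℝ) / m) ((p.2 : ℝ) / m) with h | h
    · rw [h]
      gcongr
      · exact le_add_of_nonneg_right (by positivity)
      · exact le_add_of_nonneg_right (by positivity)
    · rw [h]
      gcongr
      · exact le_add_of_nonneg_left (by positivity)
      · exact le_add_of_nonneg_left (by positivity)
  refine (norm_integral_le_of_norm_le (((j2.fun_add j2').const_mul A).fun_add ((j4.fun_add j4').const_mul C))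
    (ae_of_all _ hbd)).trans ?_
  rw [integral_add ((j2.fun_add j2').const_mul A) ((j4.fun_add j4').const_mul C), integral_const_mul,
    integral_const_mul]
  rw [integral_add j2 j2', integral_add j4 j4',
    integral_fun_fst (fun k : ℕ => ((k : ℝ) / m - x) ^ 2),
    integral_fun_snd (fun k : ℕ => ((k : ℝ) / m - x) ^ 2),
    integral_fun_fst (fun k : ℕ => ((k : ℝ) / m - x) ^ 4),
    integral_fun_snd (fun k : ℕ => ((k : ℝ) / m - x) ^ 4), h2, Real.norm_of_nonneg (by positivity)]
  simp only [probReal_univ, one_smul]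
  have h5 : C * ∫ k : ℕ, ((k : ℝ) / m - x) ^ 4 ∂ν ≤ C * ((3 * x ^ 2 + x) * (m : ℝ)⁻¹) := by
    gcongr
    refine h4.trans ?_
    rw [div_eq_mul_inv]
    gcongr
    nlinarith
  rw [div_eq_mul_inv (x : ℝ)]
  linarith

/-- The variance of the Szasz estimator is `n⁻¹` times the difference of the two integrals. -/
theorem isLittleO_integral_min_sub_sq_integral_poissonMeasure {F f : ℝ → ℝ} {f'x B : ℝ}
    {x : ℝ≥0} (hx : x ≠ 0)
    (hf : ∀ t ∈ Set.Ici (0 : ℝ), HasDerivWithinAt F (f t) (Set.Ici 0) t)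
    (hf' : HasDerivWithinAt f f'x (Set.Ici 0) x)
    (hB : ∀ t, |F t| ≤ B) :
    (fun m : ℕ => (∫ p : ℕ × ℕ, F (min ((p.1 : ℝ) / m) ((p.2 : ℝ) / m))
        ∂((poissonMeasure (m * x)).prod (poissonMeasure (m * x)))
        - (∫ k : ℕ, F ((k : ℝ) / m) ∂poissonMeasure (m * x)) ^ 2)
      - (F x * (1 - F x) - (m : ℝ) ^ (-(1 / 2) : ℝ) * (f x * √(x / Real.pi)))) =o[atTop]
      fun m : ℕ => (m : ℝ) ^ (-(1 / 2) : ℝ) := by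
  have hpow : ∀ m : ℕ, (m : ℝ) ^ (-(1 / 2) : ℝ) = (√(m : ℝ))⁻¹ := fun m => by
    rw [Real.rpow_neg (Nat.cast_nonneg m), Real.sqrt_eq_rpow]
  simp_rw [hpow]
  have hsmall : (fun m : ℕ => (m : ℝ)⁻¹) =o[atTop] fun m : ℕ => (√(m : ℝ))⁻¹ := by
    have h0 : Tendsto (fun m : ℕ => (√(m : ℝ))⁻¹) atTop (𝓝 0) :=
      tendsto_inv_atTop_zero.comp <| Real.tendsto_sqrt_atTop.comp tendsto_natCast_atTop_atTop
    have := ((isLittleO_one_iff ℝ).2 h0).mul_isBigO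
      (isBigO_refl (fun m : ℕ => (√(m : ℝ))⁻¹) atTop)
    refine this.congr (fun m => ?_) fun m => one_mul _
    rw [← mul_inv, Real.mul_self_sqrt (Nat.cast_nonneg m)]
  have hmin := (isBigO_integral_min_poissonMeasure_prod hx hf hf' hB).trans_isLittleO hsmall
  set I : ℕ → ℝ := fun m => ∫ k : ℕ, F ((k : ℝ) / m) ∂poissonMeasure (m * x) with hI
  set D : ℕ → ℝ := fun m => ∫ p : ℕ × ℕ, |(p.1 : ℝ) - p.2|
    ∂((poissonMeasure (m * x)).prod (poissonMeasure (m * x))) with hD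
  have hmean : (fun m : ℕ => I m - F x) =O[atTop] fun m : ℕ => (m : ℝ)⁻¹ := by
    refine ((isLittleO_integral_poissonMeasure_sub hx hf hf' hB).isBigO.add
      ((isBigO_refl (fun m : ℕ => (m : ℝ)⁻¹) atTop).const_mul_left (x * f'x / 2))).congr_left
      fun m => ?_
    ring
  -- Factor as `(I m + F x)(I m - F x) = O(1) · O(1/m)`.
  have hsq : (fun m : ℕ => I m ^ 2 - F x ^ 2) =o[atTop] fun m : ℕ => (√(m : ℝ))⁻¹ := by
    have hb : (fun m : ℕ => I m + F x) =O[atTop] fun _ : ℕ => (1 : ℝ) := by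
      refine IsBigO.of_bound (2 * B) (Eventually.of_forall fun m => ?_)
      have h1 : ‖I m‖ ≤ B := by
        simpa using norm_integral_le_of_norm_le_const (μ := poissonMeasure (m * x))
          (f := fun k : ℕ => F ((k : ℝ) / m)) (C := B) (ae_of_all _ fun k => hB _)
      have h2 : ‖F x‖ ≤ B := hB _
      have := norm_add_le (I m) (F x)
      simp only [norm_one, mul_one]
      linarith
    refine ((hb.mul hmean).congr (fun m => ?_) (fun m => one_mul _)).trans_isLittleO hsmall
    ring
  have hdiff : (fun m : ℕ => f x / 2 * ((m : ℝ)⁻¹ * D m - (√(m : ℝ))⁻¹ * (2 * √(x / Real.pi))))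
      =o[atTop] fun m : ℕ => (√(m : ℝ))⁻¹ := by
    refine IsLittleO.const_mul_left ?_ _
    have h := tendsto_integral_abs_poissonMeasure_prod_sub hx
    have h0 := (isLittleO_one_iff ℝ).2 (tendsto_sub_nhds_zero_iff.2 h)
    refine ((isBigO_refl (fun m : ℕ => (√(m : ℝ))⁻¹) atTop).mul_isLittleO h0).congr
      (fun m => ?_) fun m => mul_one _
    rw [mul_sub, ← mul_assoc, ← mul_inv, Real.mul_self_sqrt (Nat.cast_nonneg m)]
  refine ((hmin.sub hsq).sub hdiff).congr_left fun m => ?_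
  ring

end SzaszAsymptotics

/-! ### Exact mean and variance of the estimator. -/

section SzaszEstimator

open scoped NNReal

theorem szaszOperator_eq_integral_poissonMeasure (m : ℕ) (u : ℝ → ℝ) (x : ℝ≥0) :
    szaszOperator m u x = ∫ k : ℕ, u ((k : ℝ) / m) ∂poissonMeasure (m * x) := by
  rw [integral_poissonMeasure, szaszOperator]
  refine tsum_congr fun k => ?_
  rw [szaszWeight, smul_eq_mul, mul_comm]
  push_cast
  rfl

/-- The Szasz estimator based on the single observation `y`. -/
noncomputable def szaszKernel (m : ℕ) (x : ℝ≥0) (y : ℝ) : ℝ :=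
  ∫ k : ℕ, (Set.Iic ((k : ℝ) / m)).indicator (fun _ => (1 : ℝ)) y ∂poissonMeasure (m * x)

theorem indicator_one_mem_Icc (s : Set ℝ) (y : ℝ) :
    s.indicator (fun _ => (1 : ℝ)) y ∈ Set.Icc (0 : ℝ) 1 :=
  ⟨Set.indicator_nonneg (fun _ _ => zero_le_one) y,
    Set.indicator_le' (fun _ _ => le_rfl) (fun _ _ => zero_le_one) y⟩

theorem integrable_indicator_Iic_poissonMeasure (r : ℝ≥0) (m : ℕ) (y : ℝ) :
    Integrable (fun k : ℕ => (Set.Iic ((k : ℝ) / m)).indicator (fun _ => (1 : ℝ)) y)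
      (poissonMeasure r) :=
  Integrable.of_bound .of_discrete 1 (ae_of_all _ fun k => by
    have h := indicator_one_mem_Icc (Set.Iic ((k : ℝ) / m)) y
    rw [Real.norm_of_nonneg h.1]
    exact h.2)

theorem szaszKernel_nonneg (m : ℕ) (x : ℝ≥0) (y : ℝ) : 0 ≤ szaszKernel m x y :=
  integral_nonneg fun _ => (indicator_one_mem_Icc _ _).1

theorem szaszKernel_le_one (m : ℕ) (x : ℝ≥0) (y : ℝ) : szaszKernel m x y ≤ 1 := by
  refine (integral_mono (integrable_indicator_Iic_poissonMeasure _ m y) (integrable_const 1)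
    fun k => (indicator_one_mem_Icc _ _).2).trans ?_
  simp

/-- Supplies measurability of the kernel. -/
theorem antitone_szaszKernel (m : ℕ) (x : ℝ≥0) : Antitone (szaszKernel m x) := by
  intro y z hyz
  refine integral_mono (integrable_indicator_Iic_poissonMeasure _ m z)
    (integrable_indicator_Iic_poissonMeasure _ m y) fun k => ?_
  by_cases h : z ∈ Set.Iic ((k : ℝ) / m)
  · have h' : y ∈ Set.Iic ((k : ℝ) / m) := hyz.trans h
    simp [Set.indicator_of_mem h, Set.indicator_of_mem h']
  · rw [Set.indicator_of_notMem h]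
    exact (indicator_one_mem_Icc _ _).1

theorem measurable_szaszKernel (m : ℕ) (x : ℝ≥0) : Measurable (szaszKernel m x) :=
  (antitone_szaszKernel m x).measurable

variable {Ω : Type*}

theorem szaszEstimator_eq_sum (X : ℕ → Ω → ℝ) (m n : ℕ) (x : ℝ≥0) :
    szaszEstimator X m n x =
      fun ω => (n : ℝ)⁻¹ * (∑ i ∈ Finset.range n, szaszKernel m x ∘ X i) ω := by
  ext ω
  rw [szaszEstimator, szaszOperator_eq_integral_poissonMeasure]
  simp only [empiricalCDF, one_div]
  rw [integral_const_mul, integral_finsetSum _ fun i _ =>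
    integrable_indicator_Iic_poissonMeasure _ m (X i ω)]
  simp [szaszKernel]

variable [MeasurableSpace Ω] {P : Measure Ω} [IsProbabilityMeasure P]

theorem integral_indicator_Iic {Y : Ω → ℝ} (hY : Measurable Y) (t : ℝ) :
    ∫ ω, (Set.Iic t).indicator (fun _ => (1 : ℝ)) (Y ω) ∂P = cdf (P.map Y) t := by
  have := Measure.isProbabilityMeasure_map (μ := P) hY.aemeasurable
  rw [cdf_eq_real, ← integral_map hY.aemeasurable
    (measurable_const.indicator measurableSet_Iic).aestronglyMeasurable,
    integral_indicator measurableSet_Iic]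
  simp

theorem measurable_indicator_Iic_uncurry {β : Type*} [MeasurableSpace β] [Countable β]
    [MeasurableSingletonClass β] {Y : Ω → ℝ} (hY : Measurable Y) (g : β → ℝ) :
    Measurable (fun p : Ω × β => (Set.Iic (g p.2)).indicator (fun _ => (1 : ℝ)) (Y p.1)) := by
  have hs : MeasurableSet {p : Ω × β | Y p.1 ≤ g p.2} :=
    measurableSet_le (hY.comp measurable_fst) ((measurable_of_countable g).comp measurable_snd)
  exact measurable_const.indicator hs

/-- Fubini for a bounded integrand. The index type is general so as to serve `ℕ` for the mean and `ℕ
× ℕ` for the second moment. -/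
theorem integral_integral_indicator_Iic {β : Type*} [MeasurableSpace β] [Countable β]
    [MeasurableSingletonClass β] {κ : Measure β} [IsProbabilityMeasure κ]
    {Y : Ω → ℝ} (hY : Measurable Y) (g : β → ℝ) :
    ∫ ω, ∫ b, (Set.Iic (g b)).indicator (fun _ => (1 : ℝ)) (Y ω) ∂κ ∂P =
      ∫ b, cdf (P.map Y) (g b) ∂κ := by
  rw [integral_integral_swap]
  · simp_rw [integral_indicator_Iic hY]
  · refine Integrable.of_bound (measurable_indicator_Iic_uncurry hY g).aestronglyMeasurable 1
      (ae_of_all _ fun p => ?_)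
    have h := indicator_one_mem_Icc (Set.Iic (g p.2)) (Y p.1)
    simp only [Function.uncurry]
    rw [Real.norm_of_nonneg h.1]
    exact h.2

theorem integral_szaszKernel {Y : Ω → ℝ} (hY : Measurable Y) (m : ℕ) (x : ℝ≥0) :
    ∫ ω, szaszKernel m x (Y ω) ∂P =
      ∫ k : ℕ, cdf (P.map Y) ((k : ℝ) / m) ∂poissonMeasure (m * x) :=
  integral_integral_indicator_Iic hY fun k : ℕ => (k : ℝ) / m

/-- A squared integral is an integral over two independent copies, and `y ≤ a`, `y ≤ b` together
mean `y ≤ min a b`. -/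
theorem szaszKernel_sq (m : ℕ) (x : ℝ≥0) (y : ℝ) :
    szaszKernel m x y ^ 2 =
      ∫ p : ℕ × ℕ, (Set.Iic (min ((p.1 : ℝ) / m) ((p.2 : ℝ) / m))).indicator (fun _ => (1 : ℝ)) y
        ∂((poissonMeasure (m * x)).prod (poissonMeasure (m * x))) := by
  rw [pow_two, szaszKernel, ← integral_prod_mul]
  refine integral_congr_ae (ae_of_all _ fun p => ?_)
  simp only [Set.indicator_apply, Set.mem_Iic, le_min_iff]
  split_ifs <;> simp_all

theorem integral_szaszKernel_sq {Y : Ω → ℝ} (hY : Measurable Y) (m : ℕ) (x : ℝ≥0) :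
    ∫ ω, szaszKernel m x (Y ω) ^ 2 ∂P =
      ∫ p : ℕ × ℕ, cdf (P.map Y) (min ((p.1 : ℝ) / m) ((p.2 : ℝ) / m))
        ∂((poissonMeasure (m * x)).prod (poissonMeasure (m * x))) := by
  simp_rw [szaszKernel_sq]
  exact integral_integral_indicator_Iic hY fun p : ℕ × ℕ => min ((p.1 : ℝ) / m) ((p.2 : ℝ) / m)

theorem memLp_szaszKernel_comp {Y : Ω → ℝ} (hY : Measurable Y) (m : ℕ) (x : ℝ≥0) :
    MemLp (szaszKernel m x ∘ Y) 2 P :=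
  MemLp.of_bound ((measurable_szaszKernel m x).comp hY).aestronglyMeasurable 1
    (ae_of_all _ fun ω => by
      rw [Function.comp_apply, Real.norm_of_nonneg (szaszKernel_nonneg _ _ _)]
      exact szaszKernel_le_one _ _ _)

theorem memLp_szaszEstimator {X : ℕ → Ω → ℝ} (hX : ∀ i, Measurable (X i)) (m n : ℕ) (x : ℝ≥0) :
    MemLp (szaszEstimator X m n x) 2 P := by
  rw [szaszEstimator_eq_sum]
  exact (memLp_finsetSum' _ fun i _ => memLp_szaszKernel_comp (hX i) m x).const_mul _

theorem integral_szaszEstimator {X : ℕ → Ω → ℝ} (hX : ∀ i, Measurable (X i))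
    (hident : ∀ i, IdentDistrib (X i) (X 0) P P) (m : ℕ) {n : ℕ} (hn : n ≠ 0) (x : ℝ≥0) :
    ∫ ω, szaszEstimator X m n x ω ∂P =
      ∫ k : ℕ, cdf (P.map (X 0)) ((k : ℝ) / m) ∂poissonMeasure (m * x) := by
  rw [szaszEstimator_eq_sum, integral_const_mul]
  simp only [Finset.sum_apply]
  rw [integral_finsetSum _ fun i _ => (memLp_szaszKernel_comp (hX i) m x).integrable one_le_two]
  have h : ∀ i, ∫ ω, (szaszKernel m x ∘ X i) ω ∂P = ∫ ω, szaszKernel m x (X 0 ω) ∂P := fun i =>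
    ((hident i).comp (measurable_szaszKernel m x)).integral_eq
  simp_rw [h]
  rw [Finset.sum_const, Finset.card_range, nsmul_eq_mul,
    inv_mul_cancel_left₀ (Nat.cast_ne_zero.2 hn), integral_szaszKernel (hX 0)]

theorem variance_szaszEstimator {X : ℕ → Ω → ℝ} (hX : ∀ i, Measurable (X i))
    (hindep : iIndepFun X P) (hident : ∀ i, IdentDistrib (X i) (X 0) P P) (m n : ℕ) (x : ℝ≥0) :
    variance (szaszEstimator X m n x) P = (n : ℝ)⁻¹ *
      (∫ p : ℕ × ℕ, cdf (P.map (X 0)) (min ((p.1 : ℝ) / m) ((p.2 : ℝ) / m))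
        ∂((poissonMeasure (m * x)).prod (poissonMeasure (m * x))) -
      (∫ k : ℕ, cdf (P.map (X 0)) ((k : ℝ) / m) ∂poissonMeasure (m * x)) ^ 2) := by
  have hG := measurable_szaszKernel m x
  rw [szaszEstimator_eq_sum, variance_const_mul,
    IndepFun.variance_sum (fun i _ => memLp_szaszKernel_comp (hX i) m x)
      fun i _ j _ hij => (hindep.indepFun hij).comp hG hG]
  have h : ∀ i, variance (szaszKernel m x ∘ X i) P = variance (szaszKernel m x ∘ X 0) P :=
    fun i => ((hident i).comp hG).variance_eq
  simp_rw [h]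
  rw [Finset.sum_const, Finset.card_range, nsmul_eq_mul,
    variance_eq_sub (memLp_szaszKernel_comp (hX 0) m x)]
  simp only [Pi.pow_apply, Function.comp_apply]
  rw [integral_szaszKernel (hX 0), integral_szaszKernel_sq (hX 0)]
  -- For `n = 0` both sides vanish because `0⁻¹ = 0`.
  rcases eq_or_ne n 0 with rfl | hn
  · simp
  · have : (n : ℝ) ≠ 0 := Nat.cast_ne_zero.2 hn
    field_simp

end SzaszEstimator

theorem mainTheorem1 {Ω : Type*} [MeasurableSpace Ω] (P : Measure Ω) [IsProbabilityMeasure P]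
    (X : ℕ → Ω → ℝ)
    (hXmeas : ∀ i, Measurable (X i))
    (hXnonneg : ∀ i, ∀ᵐ ω ∂P, 0 ≤ X i ω)
    (hXindep : iIndepFun X P)
    (hXident : ∀ i, IdentDistrib (X i) (X 0) P P)
    (F f f' : ℝ → ℝ)
    (hF : ∀ t, F t = cdf (P.map (X 0)) t)
    (hFcont : Continuous F)
    (hf : ∀ t ∈ Set.Ici (0 : ℝ), HasDerivWithinAt F (f t) (Set.Ici 0) t)
    (hf' : ∀ t ∈ Set.Ici (0 : ℝ), HasDerivWithinAt f (f' t) (Set.Ici 0) t)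
    (hfcont : ContinuousOn f (Set.Ici 0))
    (hf'cont : ContinuousOn f' (Set.Ici 0))
    (hfbdd : ∃ C, ∀ t ∈ Set.Ici (0 : ℝ), |f t| ≤ C)
    (hf'bdd : ∃ C, ∀ t ∈ Set.Ici (0 : ℝ), |f' t| ≤ C)
    (x : ℝ) (hx : 0 < x) :
    (∀ m n : ℕ, MemLp (szaszEstimator X m n x) 2 P) ∧
    ((fun p : ℕ × ℕ =>
        estimatorBias P (szaszEstimator X p.1 p.2 x) (F x)
          - (p.1 : ℝ)⁻¹ * (x * f' x / 2))
      =o[atTop ×ˢ atTop] fun p : ℕ × ℕ => (p.1 : ℝ)⁻¹) ∧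
    ((fun p : ℕ × ℕ =>
        variance (szaszEstimator X p.1 p.2 x) P
          - ((p.2 : ℝ)⁻¹ * (F x * (1 - F x))
            - (p.1 : ℝ) ^ (-(1 / 2) : ℝ) * (p.2 : ℝ)⁻¹ * (f x * √(x / Real.pi))))
      =o[atTop ×ˢ atTop] fun p : ℕ × ℕ => (p.1 : ℝ) ^ (-(1 / 2) : ℝ) * (p.2 : ℝ)⁻¹) := by
  lift x to NNReal using hx.le
  have hx' : x ≠ 0 := by
    rintro rfl
    simp at hx
  have hB : ∀ t, |F t| ≤ 1 := fun t => by
    rw [hF, abs_of_nonneg (cdf_nonneg _ _)]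
    exact cdf_le_one _ _
  obtain rfl : F = cdf (P.map (X 0)) := funext hF
  have hf'x := hf' x hx.le
  refine ⟨fun m n => memLp_szaszEstimator hXmeas m n x, ?_, ?_⟩
  -- The bias is the same for all `n ≠ 0`, so the limit in `m` pulls back along the first
  -- projection.
  · refine ((isLittleO_integral_poissonMeasure_sub hx' hf hf'x hB).comp_tendsto
      (tendsto_fst (f := atTop) (g := (atTop : Filter ℕ)))).congr' ?_ EventuallyEq.rfl
    filter_upwards [tendsto_snd.eventually (eventually_ne_atTop 0)] with p hp
    simp only [Function.comp_apply]
    rw [estimatorBias, integral_szaszEstimator hXmeas hXident _ hp]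
  -- Here `n` enters only through the exact factor `n⁻¹`, also present in the error scale.
  · refine (((isLittleO_integral_min_sub_sq_integral_poissonMeasure hx' hf hf'x hB).comp_tendsto
      (tendsto_fst (f := atTop) (g := (atTop : Filter ℕ)))).mul_isBigO
      (isBigO_refl (fun p : ℕ × ℕ => (p.2 : ℝ)⁻¹) _)).congr_left fun p => ?_
    simp only [Function.comp_apply]
    rw [variance_szaszEstimator hXmeas hXindep hXident]
    ring
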